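/- All graphs are finite and simple. For a graph $G$ and $X\subseteq V(G)$, let $N_G[X]$ be the set of vertices that belong to $X$ or are adjacent to a vertex of $X$. The isolation game on $G$ is played by two players, Dominator and Staller, who alternately select vertices of $G$; if $X$ is the set of vertices already selected, then a vertex $v$ may be selected only if $N_G[\{v\}]$ contains a vertex of a nontrivial component (a component with at least two vertices) of $G-N_G[X]$. The game ends when no vertex may be selected. Dominator wants to minimize the number of selected vertices and Staller wants to maximize it. The game isolation number $\iota_{\rm g}(G)$ is the number of vertices selected when Dominator makes the first move and both players play optimally. Theorem. If $G$ is a connected graph of order $n$, then $\iota_{\rm g}(G)\le \frac{1}{2}n$, with equality if and only if $G$ is isomorphic to $K_2$ or to $C_6$. -/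

import Mathlib

namespace IsolationGame

variable {V : Type*}

/-- The closed neighborhood `N[X]`: all vertices that are in `X` or adjacent to a vertex of `X`.
A vertex `u` is dominated by `v` when `u ∈ N[{v}]`. -/
def closedNbhd (G : SimpleGraph V) (X : Set V) : Set V :=
  {u | ∃ x ∈ X, u = x ∨ G.Adj x u}

/-- `u` is a vertex of a nontrivial component (one with at least two vertices) of the graph
`G - N[X]`, the subgraph of `G` induced by the complement of `N[X]`. -/
def InNontrivialComponent (G : SimpleGraph V) (X : Set V) (u : V) : Prop :=
  ∃ h : u ∈ (closedNbhd G X)ᶜ,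
    ((G.induce (closedNbhd G X)ᶜ).connectedComponentMk ⟨u, h⟩).supp.Nontrivial

/-- When `X` is the set of vertices played so far, `v` may be played if and only if it dominates
some vertex of a nontrivial component of `G - N[X]`. -/
def Playable (G : SimpleGraph V) (X : Set V) (v : V) : Prop :=
  ∃ u ∈ closedNbhd G {v}, InNontrivialComponent G X u

/-- A playable vertex has not been played before. -/
theorem Playable.notMem {G : SimpleGraph V} {X : Set V} {v : V} (h : Playable G X v) :
    v ∉ X := by
  rintro hv
  obtain ⟨u, ⟨x, rfl, hxu⟩, hu, -⟩ := h
  exact hu ⟨x, hv, hxu⟩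

/-- The two players. -/
inductive Player
  | dominator
  | staller

open Classical in
/-- The number of moves still to be made under optimal play when `X` is the set of vertices played
so far and `p` is to move: the game ends when no vertex is playable; Dominator minimizes
and Staller maximizes the number of moves. The minimum and the maximum are taken over a finite
nonempty set, so they are attained. -/
noncomputable def movesLeft [Fintype V] (G : SimpleGraph V) (p : Player) (X : Finset V) : ℕ :=
  if ∃ v, Playable G X v then
    match p with
    | .dominator => 1 + ⨅ v : {v : V // Playable G X v}, movesLeft G .staller (insert v.1 X)
    | .staller => 1 + ⨆ v : {v : V // Playable G X v}, movesLeft G .dominator (insert v.1 X)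
  else 0
termination_by Fintype.card V - X.card
decreasing_by
  all_goals
    have hv : v.1 ∉ X := fun h => v.2.notMem (Finset.mem_coe.2 h)
    have h1 := Finset.card_insert_of_notMem hv
    have h2 := Finset.card_le_univ (insert v.1 X)
    omega

/-- The game isolation number: the number of moves in the Dominator-start isolation game when
both players play optimally. -/
noncomputable def gameIsolationNumber [Fintype V] (G : SimpleGraph V) : ℕ :=
  movesLeft G .dominator ∅

end IsolationGame

/-! Call a vertex active if it and some neighbor are undominated. Let D and S be the numbers of
moves left with Dominator or Staller to move, and A the number of active vertices.
`two_mul_movesLeft_le` proves 2D ≤ A and 2S ≤ A + 1 together. Every move of Staller removes at least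
one active vertex. Dominator can remove three unless all active components are edges, and then every
move removes two.

If Dominator can ever remove four, the bound is strict (`two_mul_movesLeft_dominator_lt`). An
extremal graph of order at least 4 thus has no vertex of degree three and no leaf, so it is a cycle.
After Dominator plays v, Staller must remove a single vertex by playing a neighbor of v. The active
vertices left form a path, and four or more of them would allow Dominator to remove four. This
leaves orders 6 and 7, and parity excludes 7. -/

namespace IsolationGame

open Finset

variable {V : Type*} {G : SimpleGraph V}

/-- The first edge of a walk to another vertex of the component gives the neighbor, so activity is a
local condition. -/
theorem inNontrivialComponent_iff {X : Set V} {u : V} :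
    InNontrivialComponent G X u ↔
      u ∉ closedNbhd G X ∧ ∃ w, G.Adj u w ∧ w ∉ closedNbhd G X := by
  constructor
  · rintro ⟨h, hn⟩
    refine ⟨h, ?_⟩
    obtain ⟨w, hw, hne⟩ := hn.exists_ne ⟨u, h⟩
    have hr : (G.induce (closedNbhd G X)ᶜ).Reachable ⟨u, h⟩ w :=
      (SimpleGraph.ConnectedComponent.exact hw).symm
    obtain ⟨p⟩ := hr
    cases p with
    | nil => exact absurd rfl hne
    | @cons _ x _ hadj p => exact ⟨x.1, hadj, x.2⟩
  · rintro ⟨h, w, hadj, hw⟩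
    refine ⟨h, ⟨u, h⟩, rfl, ⟨w, hw⟩, ?_, fun he => hadj.ne (congrArg Subtype.val he)⟩
    refine SimpleGraph.ConnectedComponent.sound (SimpleGraph.Adj.reachable ?_)
    exact hadj.symm

theorem mem_closedNbhd_insert {X : Set V} {u v : V} :
    u ∈ closedNbhd G (insert v X) ↔ (u = v ∨ G.Adj v u) ∨ u ∈ closedNbhd G X := by
  simp [closedNbhd]

theorem mem_closedNbhd_singleton {u v : V} :
    u ∈ closedNbhd G {v} ↔ u = v ∨ G.Adj v u := by
  simp [closedNbhd]

theorem notMem_closedNbhd_empty {u : V} : u ∉ closedNbhd G ∅ := by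
  simp [closedNbhd]

/-- The two cyclic neighbors of each vertex exhaust its degree, so there are no chords. -/
theorem nonempty_iso_cycleGraph_six
    (hdeg : ∀ v x y z, G.Adj v x → G.Adj v y → G.Adj v z → x = y ∨ x = z ∨ y = z)
    (f : Fin 6 → V) (hf : Function.Bijective f) (hadj : ∀ i, G.Adj (f i) (f (i + 1))) :
    Nonempty (G ≃g SimpleGraph.cycleGraph 6) := by
  refine ⟨RelIso.symm ⟨Equiv.ofBijective f hf, @fun i j => ?_⟩⟩
  have hc : ∀ i j : Fin 6, (SimpleGraph.cycleGraph 6).Adj i j ↔ j = i + 1 ∨ i = j + 1 := by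
    decide
  rw [hc]
  constructor
  · intro h
    change G.Adj (f i) (f j) at h
    have h' := (hadj (i - 1)).symm
    rw [sub_add_cancel] at h'
    rcases hdeg _ _ _ _ h (hadj i) h' with h | h | h
    · exact .inl (hf.1 h)
    · exact .inr (by rw [hf.1 h, sub_add_cancel])
    · exact absurd (hf.1 h) ((by decide : ∀ i : Fin 6, i + 1 ≠ i - 1) i)
  · rintro (rfl | rfl)
    · exact hadj i
    · exact (hadj j).symm

/-! ### Active vertices and their loss under a move -/

variable [Fintype V]

open Classical in
/-- The vertices of the nontrivial components of `G - N[X]`. -/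
noncomputable def active (G : SimpleGraph V) (X : Finset V) : Finset V :=
  {u | InNontrivialComponent G X u}

theorem mem_active {X : Finset V} {u : V} :
    u ∈ active G X ↔
      u ∉ closedNbhd G (X : Set V) ∧ ∃ w, G.Adj u w ∧ w ∉ closedNbhd G (X : Set V) := by
  simp [active, inNontrivialComponent_iff]

theorem mem_active_of_adj {X : Finset V} {u w : V} (hu : u ∈ active G X) (h : G.Adj u w)
    (hw : w ∉ closedNbhd G (X : Set V)) : w ∈ active G X :=
  mem_active.2 ⟨hw, u, h.symm, (mem_active.1 hu).1⟩

theorem exists_adj_mem_active {X : Finset V} {u : V} (hu : u ∈ active G X) :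
    ∃ w ∈ active G X, G.Adj u w := by
  obtain ⟨-, w, hw, hn⟩ := mem_active.1 hu
  exact ⟨w, mem_active_of_adj hu hw hn, hw⟩

theorem playable_iff {X : Finset V} {v : V} :
    Playable G X v ↔ ∃ u ∈ active G X, u = v ∨ G.Adj v u := by
  simp [Playable, active, mem_closedNbhd_singleton, and_comm]

theorem playable_of_mem_active {X : Finset V} {v : V} (h : v ∈ active G X) : Playable G X v :=
  playable_iff.2 ⟨v, h, .inl rfl⟩

open Classical in
theorem mem_active_insert {X : Finset V} {u v : V} :
    u ∈ active G (insert v X) ↔ (u ∈ active G X ∧ u ≠ v ∧ ¬ G.Adj v u) ∧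
      ∃ w ∈ active G X, G.Adj u w ∧ w ≠ v ∧ ¬ G.Adj v w := by
  simp only [mem_active, coe_insert, mem_closedNbhd_insert]
  constructor
  · rintro ⟨h, w, hw, h'⟩
    push Not at h h'
    exact ⟨⟨⟨h.2, w, hw, h'.2⟩, h.1⟩, w, ⟨h'.2, u, hw.symm, h.2⟩, hw, h'.1⟩
  · rintro ⟨⟨h, h1⟩, w, h', hw, h2⟩
    exact ⟨by tauto, w, hw, by tauto⟩

open Classical in
theorem active_insert_subset {X : Finset V} {v : V} : active G (insert v X) ⊆ active G X :=
  fun _ h => (mem_active_insert.1 h).1.1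

open Classical in
theorem card_active_insert_add_le {X T : Finset V} {v : V} (hT : T ⊆ active G X)
    (hd : ∀ u ∈ T, u ∉ active G (insert v X)) :
    #(active G (insert v X)) + #T ≤ #(active G X) := by
  rw [← card_union_of_disjoint (Finset.disjoint_right.2 hd)]
  exact card_le_card (union_subset active_insert_subset hT)

open Classical in
theorem card_active_insert_lt {X : Finset V} {v : V} (h : Playable G X v) :
    #(active G (insert v X)) + 1 ≤ #(active G X) := by
  obtain ⟨u, hu, huv⟩ := playable_iff.1 h
  refine card_active_insert_add_le (T := {u}) (by simpa) fun x hx => ?_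
  rw [mem_singleton] at hx
  subst hx
  rw [mem_active_insert]
  tauto

/-! ### Comparing the game value with single moves -/

open Classical in
theorem movesLeft_dominator_le {X : Finset V} {v : V} (h : Playable G X v) :
    movesLeft G .dominator X ≤ 1 + movesLeft G .staller (insert v X) := by
  conv_lhs => rw [movesLeft.eq_def, if_pos ⟨v, h⟩]
  exact Nat.add_le_add_left (ciInf_le (OrderBot.bddBelow _) (⟨v, h⟩ : {v : V // Playable G X v})) 1

open Classical in
theorem le_movesLeft_staller {X : Finset V} {v : V} (h : Playable G X v) :
    1 + movesLeft G .dominator (insert v X) ≤ movesLeft G .staller X := by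
  conv_rhs => rw [movesLeft, if_pos ⟨v, h⟩]
  -- An unbounded supremum in `ℕ` is 0 by default, hence the appeal to finiteness.
  exact Nat.add_le_add_left (le_ciSup (f := fun v : {v : V // Playable G X v} =>
    movesLeft G .dominator (insert v.1 X)) (Set.finite_range _).bddAbove ⟨v, h⟩) 1

theorem movesLeft_eq_zero {X : Finset V} (h : ¬ ∃ v, Playable G X v) (p : Player) :
    movesLeft G p X = 0 := by
  rw [movesLeft.eq_def, if_neg h]

open Classical in
theorem movesLeft_staller_le {X : Finset V} {k : ℕ}
    (h : ∀ v, Playable G X v → 1 + movesLeft G .dominator (insert v X) ≤ k) :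
    movesLeft G .staller X ≤ k := by
  by_cases hX : ∃ v, Playable G X v
  · rw [movesLeft, if_pos hX]
    have : Nonempty {v : V // Playable G X v} := nonempty_subtype.2 hX
    obtain ⟨v, hv⟩ := exists_eq_ciSup_of_finite
      (f := fun v : {v : V // Playable G X v} => movesLeft G .dominator (insert v.1 X))
    have := h v.1 v.2
    rw [← hv]
    exact this
  · rw [movesLeft_eq_zero hX]
    exact Nat.zero_le k

-- Without a playable vertex the value is 0 and the bound over moves is vacuous, so `hX` is needed.
open Classical in
theorem le_movesLeft_dominator {X : Finset V} {k : ℕ} (hX : ∃ v, Playable G X v)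
    (h : ∀ v, Playable G X v → k ≤ 1 + movesLeft G .staller (insert v X)) :
    k ≤ movesLeft G .dominator X := by
  rw [movesLeft, if_pos hX]
  have : Nonempty {v : V // Playable G X v} := nonempty_subtype.2 hX
  obtain ⟨v, hv⟩ := exists_eq_ciInf_of_finite
    (f := fun v : {v : V // Playable G X v} => movesLeft G .staller (insert v.1 X))
  have := h v.1 v.2
  rw [← hv]
  exact this

/-! ### The bound by half the number of active vertices -/

/-- If all nontrivial components of `G - N[X]` have order two, then every move removes at least one
of them. -/
theorem two_mul_movesLeft_le_of_unique_adj (X : Finset V) (p : Player)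
    (hX : ∀ u ∈ active G X, ∀ a ∈ active G X, ∀ b ∈ active G X, G.Adj u a → G.Adj u b → a = b) :
    2 * movesLeft G p X ≤ #(active G X) := by
  classical
  induction hn : #(active G X) using Nat.strong_induction_on generalizing X p with
  | _ n ih =>
    subst hn
    have key : ∀ v, Playable G X v → ∀ p,
        2 * (1 + movesLeft G p (insert v X)) ≤ #(active G X) := by
      intro v hv p
      obtain ⟨u, hu, huv⟩ := playable_iff.1 hv
      obtain ⟨w, hw, huw⟩ := exists_adj_mem_active hu
      have hc : #(active G (insert v X)) + #{u, w} ≤ #(active G X) := by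
        refine card_active_insert_add_le (by simp [insert_subset_iff, hu, hw]) fun x hx => ?_
        rw [mem_active_insert]
        rintro ⟨⟨-, hx1⟩, y, hy, hxy, hy1⟩
        rw [mem_insert, mem_singleton] at hx
        obtain rfl | rfl := hx
        · tauto
        · obtain rfl := hX x hw y hy u hu hxy huw.symm
          tauto
      rw [card_pair huw.ne] at hc
      have := ih _ (by omega) (insert v X) p (fun u hu a ha b hb => hX u (active_insert_subset hu)
        a (active_insert_subset ha) b (active_insert_subset hb)) rfl
      omega
    cases p with
    | dominator =>
      by_cases h : ∃ v, Playable G X v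
      · obtain ⟨v, hv⟩ := h
        have := movesLeft_dominator_le hv
        have := key v hv .staller
        omega
      · simp [movesLeft_eq_zero h]
    | staller =>
      have : movesLeft G .staller X ≤ #(active G X) / 2 :=
        movesLeft_staller_le fun v hv => by have := key v hv .dominator; omega
      omega

theorem two_mul_movesLeft_le (X : Finset V) :
    2 * movesLeft G .dominator X ≤ #(active G X) ∧
      2 * movesLeft G .staller X ≤ #(active G X) + 1 := by
  classical
  induction hn : #(active G X) using Nat.strong_induction_on generalizing X with
  | _ n ih =>
    subst hn
    constructor
    · by_cases hX : ∀ u ∈ active G X, ∀ a ∈ active G X, ∀ b ∈ active G X,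
          G.Adj u a → G.Adj u b → a = b
      · exact two_mul_movesLeft_le_of_unique_adj X _ hX
      · push Not at hX
        obtain ⟨u, hu, a, ha, b, hb, hua, hub, hab⟩ := hX
        have hc : #(active G (insert u X)) + #{u, a, b} ≤ #(active G X) := by
          refine card_active_insert_add_le (by simp [insert_subset_iff, hu, ha, hb]) fun x hx => ?_
          simp only [mem_insert, mem_singleton] at hx
          rw [mem_active_insert]
          rintro ⟨⟨-, h1, h2⟩, -⟩
          obtain rfl | rfl | rfl := hx <;> tauto
        rw [card_eq_three.2 ⟨u, a, b, hua.ne, hub.ne, hab, rfl⟩] at hc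
        have := (ih _ (by omega) (insert u X) rfl).2
        have := movesLeft_dominator_le (playable_of_mem_active hu)
        -- Three vertices are gone: 2 + (A - 3) + 1 = A.
        omega
    · have : movesLeft G .staller X ≤ (#(active G X) + 1) / 2 := by
        refine movesLeft_staller_le fun v hv => ?_
        have hc := card_active_insert_lt hv
        have := (ih _ (by omega) (insert v X) rfl).1
        omega
      omega

/-! ### Extremal graphs -/

/-- If Dominator can remove four vertices with one move, then the general bound is not attained. -/
theorem two_mul_movesLeft_dominator_lt {X T : Finset V} {v : V} (hv : v ∈ active G X)
    (hT : T ⊆ active G X) (h4 : 4 ≤ #T)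
    (hd : ∀ u ∈ T, u = v ∨ G.Adj v u ∨ ∀ w ∈ active G X, G.Adj u w → w = v ∨ G.Adj v w) :
    2 * movesLeft G .dominator X < #(active G X) := by
  classical
  have hc : #(active G (insert v X)) + #T ≤ #(active G X) := by
    refine card_active_insert_add_le hT fun u hu => ?_
    rw [mem_active_insert]
    rintro ⟨⟨-, h1, h2⟩, w, hw, huw, h3, h4⟩
    obtain h | h | h := hd u hu
    · exact h1 h
    · exact h2 h
    · exact (h w hw huw).elim h3 h4
  have := (two_mul_movesLeft_le (G := G) (insert v X)).2
  have := movesLeft_dominator_le (playable_of_mem_active hv)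
  omega

theorem active_empty_of_connected [Nontrivial V] (hG : G.Connected) : active G ∅ = univ := by
  ext u
  obtain ⟨w, hw⟩ := hG.preconnected.exists_adj_of_nontrivial u
  simp only [mem_active, coe_empty, notMem_closedNbhd_empty, mem_univ, not_false_eq_true, and_true,
    true_and, iff_true]
  exact ⟨w, hw⟩

theorem eq_univ_of_connected (hG : G.Connected) {S : Finset V} {v : V} (hv : v ∈ S)
    (hS : ∀ x ∈ S, ∀ y, G.Adj x y → y ∈ S) : S = univ := by
  refine eq_univ_of_forall fun w => ?_
  obtain ⟨p⟩ := hG.preconnected v w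
  induction p with
  | nil => exact hv
  | cons h p ih => exact ih (hS _ hv _ h)

/-- A vertex with three neighbors is a winning first move for Dominator. -/
theorem lt_card_of_three_adj [Nontrivial V] (hG : G.Connected) {v x y z : V} (hx : G.Adj v x)
    (hy : G.Adj v y) (hz : G.Adj v z) (hxy : x ≠ y) (hxz : x ≠ z) (hyz : y ≠ z) :
    2 * gameIsolationNumber G < Fintype.card V := by
  classical
  have h := active_empty_of_connected hG
  have := two_mul_movesLeft_dominator_lt (G := G) (X := ∅) (T := {v, x, y, z}) (v := v)
    (by simp [h]) (by simp [h]) (by simp [hx.ne, hy.ne, hz.ne, hxy, hxz, hyz]) (by grind)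
  rwa [h] at this

/-- A vertex at distance two from a leaf is a winning first move for Dominator. -/
theorem lt_card_of_leaf (hG : G.Connected) (hn : 4 ≤ Fintype.card V)
    (hdeg : ∀ v x y z, G.Adj v x → G.Adj v y → G.Adj v z → x = y ∨ x = z ∨ y = z)
    {a b : V} (hab : G.Adj a b) (ha : ∀ y, G.Adj a y → y = b) :
    2 * gameIsolationNumber G < Fintype.card V := by
  classical
  have : Nontrivial V := ⟨a, b, hab.ne⟩
  have hb : ∃ c, c ≠ a ∧ G.Adj b c := by
    by_contra! hb
    have h := eq_univ_of_connected hG (S := {a, b}) (v := a) (by simp) (by grind)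
    have : #({a, b} : Finset V) ≤ 2 := card_le_two
    rw [h, card_univ] at this
    omega
  obtain ⟨c, hca, hbc⟩ := hb
  have hc : ∃ d, d ≠ b ∧ G.Adj c d := by
    by_contra! hc
    have h := eq_univ_of_connected hG (S := {a, b, c}) (v := a) (by simp)
      (by grind [G.adj_comm])
    have : #({a, b, c} : Finset V) ≤ 3 := card_le_three
    rw [h, card_univ] at this
    omega
  obtain ⟨d, hdb, hcd⟩ := hc
  have h := active_empty_of_connected hG
  have hda : d ≠ a := by rintro rfl; exact hbc.ne' (ha c hcd.symm)
  -- Playing `c` dominates `b`, `c`, `d` and isolates the leaf `a`.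
  have := two_mul_movesLeft_dominator_lt (G := G) (X := ∅) (T := {a, b, c, d}) (v := c)
    (by simp [h]) (by simp [h])
    (by simp [hab.ne, hca.symm, hda.symm, hbc.ne, hdb.symm, hcd.ne]) (by grind [G.adj_comm])
  rwa [h] at this

open Classical in
/-- In a 2-regular graph of even order, if Dominator's move `v` leaves all vertices outside `N[v]`
active and Staller's reply `a` removes just the vertex `u`, then the general bound for the resulting
position is attained only if the graph is `C₆`. -/
theorem nonempty_iso_cycleGraph_six_of_moves (hG : G.Connected) (hn : Even (Fintype.card V))
    (hdeg : ∀ v x y z, G.Adj v x → G.Adj v y → G.Adj v z → x = y ∨ x = z ∨ y = z)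
    (hdeg' : ∀ v x, G.Adj v x → ∃ y, y ≠ x ∧ G.Adj v y) {X Y : Finset V} {v a u : V}
    (hX : ∀ x, x ∈ active G X ↔ x ≠ v ∧ ¬ G.Adj v x)
    (hY : ∀ x, x ∈ active G Y ↔ x ∈ active G X ∧ x ≠ u)
    (hva : G.Adj v a) (hau : G.Adj a u) (hu : u ∈ active G X)
    (hlt : #(active G Y) ≤ 2 * movesLeft G .dominator Y) :
    Nonempty (G ≃g SimpleGraph.cycleGraph 6) := by
  obtain ⟨b, hba, hvb⟩ := hdeg' v a hva
  obtain ⟨c, hc, huc⟩ := exists_adj_mem_active hu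
  have hcY : c ∈ active G Y := (hY c).2 ⟨hc, huc.ne'⟩
  obtain ⟨d, hd, hcd⟩ := exists_adj_mem_active hcY
  obtain ⟨e, hec, hde⟩ := hdeg' d c hcd.symm
  have mem : ∀ x, x ∈ active G Y ↔ x ≠ v ∧ x ≠ a ∧ x ≠ b ∧ x ≠ u := by grind
  simp only [hX] at hu hc
  have := (mem c).1 hcY
  have := (mem d).1 hd
  have hub : u ≠ b := fun h => hu.2 (h ▸ hvb)
  have hnbr : ∀ {p q r : V}, G.Adj p q → G.Adj p r → q ≠ r → ∀ z, G.Adj p z → z = q ∨ z = r :=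
    fun {p q r} hq hr hne z hz => by
      rcases hdeg p q r z hq hr hz with h | h | h
      exacts [absurd h hne, .inl h.symm, .inr h.symm]
  have hNv := hnbr hva hvb hba.symm
  have hNa := hnbr hva.symm hau hu.1.symm
  have hNu := hnbr hau.symm huc (by tauto)
  have hNc := hnbr huc.symm hcd (by tauto)
  have hNd := hnbr hcd.symm hde hec.symm
  have hne : ∀ p q, G.Adj p q → p ≠ q := fun _ _ h => h.ne
  have hcomm : ∀ p q, G.Adj p q → G.Adj q p := fun _ _ h => h.symm
  by_cases heY : e ∈ active G Y
  · exfalso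
    have := (mem e).1 heY
    obtain ⟨f, hfd, hef⟩ := hdeg' e d hde.symm
    have hNe := hnbr hde.symm hef hfd.symm
    have hfc : f ≠ c := by
      rintro rfl
      rcases hNc e hef.symm with h | h
      exacts [by tauto, hde.ne h.symm]
    by_cases hf : f ∈ active G Y
    -- Playing `e` dominates `d`, `e`, `f` and isolates `c`, whose other neighbor `u` is inactive.
    · have := two_mul_movesLeft_dominator_lt (G := G) (X := Y) (T := {c, d, e, f}) (v := e) heY
        (by simp [insert_subset_iff, hcY, hd, heY, hf])
        (by simp [hcd.ne, hec.symm, hfc.symm, hde.ne, hfd.symm, hef.ne])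
        (by clear hdeg hdeg' hX hY hNa hNv hNu hNd hNe hlt; grind)
      omega
    -- Both neighbors of `v`, `a` and `u` are known, so only `b` can close the cycle, here with
    -- seven vertices.
    · have hfb : f = b := by clear hdeg hdeg' hX hY hlt; grind
      subst hfb
      have hNb := hnbr hvb.symm hef.symm (by tauto)
      have h := eq_univ_of_connected hG (S := {v, a, u, c, d, e, f}) (v := v) (by simp) (by
        simp only [mem_insert, mem_singleton]
        clear hdeg hdeg' hX hY hlt mem hnbr hne hcomm
        rintro x (rfl | rfl | rfl | rfl | rfl | rfl | rfl) y hy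
        exacts [
          by rcases hNv y hy with h | h <;> simp [h],
          by rcases hNa y hy with h | h <;> simp [h],
          by rcases hNu y hy with h | h <;> simp [h],
          by rcases hNc y hy with h | h <;> simp [h],
          by rcases hNd y hy with h | h <;> simp [h],
          by rcases hNe y hy with h | h <;> simp [h],
          by rcases hNb y hy with h | h <;> simp [h]])
      have h7 : #({v, a, u, c, d, e, f} : Finset V) = 7 := by
        clear hdeg hdeg' hX hY hlt mem hnbr hcomm hNv hNa hNu hNc hNd hNe hNb
        grind
      rw [h, card_univ] at h7
      rw [h7] at hn
      exact absurd hn (by decide)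
  · have heb : e = b := by clear hdeg hdeg' hX hY hlt; grind
    subst heb
    have hNb := hnbr hvb.symm hde.symm (by tauto)
    have h := eq_univ_of_connected hG (S := {v, a, u, c, d, e}) (v := v) (by simp) (by
      simp only [mem_insert, mem_singleton]
      clear hdeg hdeg' hX hY hlt mem hnbr hne hcomm
      rintro x (rfl | rfl | rfl | rfl | rfl | rfl) y hy
      exacts [
        by rcases hNv y hy with h | h <;> simp [h],
        by rcases hNa y hy with h | h <;> simp [h],
        by rcases hNu y hy with h | h <;> simp [h],
        by rcases hNc y hy with h | h <;> simp [h],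
        by rcases hNd y hy with h | h <;> simp [h],
        by rcases hNb y hy with h | h <;> simp [h]])
    have h6 : #({v, a, u, c, d, e} : Finset V) = 6 := by
      clear hdeg hdeg' hX hY hlt mem hnbr hcomm hNv hNa hNu hNc hNd hNb
      grind
    rw [h, card_univ] at h6
    refine nonempty_iso_cycleGraph_six hdeg ![v, a, u, c, d, e] ?_ ?_
    · refine (Fintype.bijective_iff_surjective_and_card _).2 ⟨fun x => ?_, by simp [h6]⟩
      have hx : x ∈ ({v, a, u, c, d, e} : Finset V) := h ▸ mem_univ x
      simp only [mem_insert, mem_singleton] at hx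
      obtain rfl | rfl | rfl | rfl | rfl | rfl := hx
      exacts [⟨0, rfl⟩, ⟨1, rfl⟩, ⟨2, rfl⟩, ⟨3, rfl⟩, ⟨4, rfl⟩, ⟨5, rfl⟩]
    · intro i
      fin_cases i
      exacts [hva, hau, huc, hcd, hde, hvb.symm]

/-- Equality makes every estimate tight: the first move removes exactly N[v], and some reply of
Staller removes exactly one vertex. -/
theorem nonempty_iso_cycleGraph_six_of_card_le (hG : G.Connected) (hn : Even (Fintype.card V))
    (h4 : 4 ≤ Fintype.card V) (hle : Fintype.card V ≤ 2 * gameIsolationNumber G) :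
    Nonempty (G ≃g SimpleGraph.cycleGraph 6) := by
  classical
  have : Nontrivial V := Fintype.one_lt_card_iff_nontrivial.1 (by omega)
  have hdeg : ∀ v x y z, G.Adj v x → G.Adj v y → G.Adj v z → x = y ∨ x = z ∨ y = z := by
    intro v x y z hx hy hz
    by_contra! h
    exact hle.not_gt (lt_card_of_three_adj hG hx hy hz h.1 h.2.1 h.2.2)
  have hdeg' : ∀ v x, G.Adj v x → ∃ y, y ≠ x ∧ G.Adj v y := by
    intro v x hx
    by_contra! h
    exact hle.not_gt (lt_card_of_leaf hG h4 hdeg hx fun y hy => by_contra fun hne => h y hne hy)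
  obtain ⟨v⟩ := hG.nonempty
  obtain ⟨a, hva⟩ := hG.preconnected.exists_adj_of_nontrivial v
  obtain ⟨b, hba, hvb⟩ := hdeg' v a hva
  have hempty := active_empty_of_connected hG
  have hv : Playable G (∅ : Finset V) v := playable_of_mem_active (by simp [hempty])
  have hD := movesLeft_dominator_le hv
  have hcard : 2 * movesLeft G .staller (insert v ∅) + 2 ≥ Fintype.card V := by
    rw [gameIsolationNumber] at hle
    omega
  have h3 : #({v, a, b} : Finset V) = 3 :=
    card_eq_three.2 ⟨v, a, b, hva.ne, hvb.ne, hba.symm, rfl⟩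
  set X : Finset V := insert v ∅
  have hcX : Fintype.card V ≤ #(active G X) + 3 := by
    have := (two_mul_movesLeft_le (G := G) X).2
    obtain ⟨k, hk⟩ := hn
    omega
  have hX : ∀ x, x ∈ active G X ↔ x ≠ v ∧ ¬ G.Adj v x := by
    have hsub : active G X ⊆ ({v, a, b} : Finset V)ᶜ := by
      intro x hx
      have := (mem_active_insert.1 hx).1
      simp only [mem_compl, mem_insert, mem_singleton]
      grind
    have heq := eq_of_subset_of_card_le hsub (by rw [card_compl, h3]; omega)
    intro x
    rw [heq]
    simp only [mem_compl, mem_insert, mem_singleton]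
    grind
  have hcX' : #(active G X) + 3 = Fintype.card V := by
    have := card_active_insert_add_le (G := G) (X := ∅) (v := v) (T := {v, a, b})
      (by simp [hempty]) (by change ∀ u ∈ _, u ∉ active G X; simp only [hX]; grind)
    rw [hempty, card_univ, h3] at this
    change #(active G X) + 3 ≤ _ at this
    omega
  obtain ⟨s, hs, hsc⟩ : ∃ s, Playable G X s ∧
      #(active G X) < 2 * (1 + movesLeft G .dominator (insert s X)) := by
    by_contra! h
    have : movesLeft G .staller X ≤ #(active G X) / 2 :=
      movesLeft_staller_le fun s hs => by have := h s hs; omega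
    omega
  have hs1 := card_active_insert_lt hs
  have hs2 := (two_mul_movesLeft_le (G := G) (insert s X)).1
  have hone : ∀ x ∈ active G X, ∀ y ∈ active G X, x ∉ active G (insert s X) →
      y ∉ active G (insert s X) → x = y := by
    intro x hx y hy hx' hy'
    by_contra hxy
    have := card_active_insert_add_le (G := G) (X := X) (v := s) (T := {x, y})
      (by simp [insert_subset_iff, hx, hy]) (by simp [hx', hy'])
    rw [card_pair hxy] at this
    omega
  obtain ⟨u, hu, hus⟩ := playable_iff.1 hs
  have hu' : u ∉ active G (insert s X) := by rw [mem_active_insert]; tauto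
  -- An active `s` would disappear together with an active neighbor.
  have hsX : s ∉ active G X := by
    intro hsX
    obtain ⟨w, hw, hsw⟩ := exists_adj_mem_active hsX
    exact hsw.ne (hone s hsX w hw (by rw [mem_active_insert]; tauto)
      (by rw [mem_active_insert]; tauto))
  have hsu : G.Adj s u := hus.resolve_left (by rintro rfl; exact hsX hu)
  have hvs : G.Adj v s := by
    by_contra h
    exact hsX ((hX s).2 ⟨by rintro rfl; exact ((hX u).1 hu).2 hsu, h⟩)
  refine nonempty_iso_cycleGraph_six_of_moves hG hn hdeg hdeg' hX (Y := insert s X) (fun x => ?_)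
    hvs hsu hu (by omega)
  refine ⟨fun h => ⟨active_insert_subset h, by rintro rfl; exact hu' h⟩, fun h => ?_⟩
  by_contra hx
  exact h.2 (hone x h.1 u hu hx hu')

/-! ### The values on C₆ and K₂, and the characterization -/

theorem three_le_gameIsolationNumber (e : G ≃g SimpleGraph.cycleGraph 6) :
    3 ≤ gameIsolationNumber G := by
  classical
  have hadj : ∀ i j, G.Adj (e.symm i) (e.symm j) ↔ (SimpleGraph.cycleGraph 6).Adj i j :=
    fun i j => e.symm.map_adj_iff
  have hne : ∀ i j, e.symm i ≠ e.symm j ↔ i ≠ j := fun i j => e.symm.injective.ne_iff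
  have hact : ∀ i, e.symm i ∈ active G (∅ : Finset V) := fun i => by
    rw [mem_active]
    simp only [coe_empty, notMem_closedNbhd_empty, not_false_eq_true, true_and, and_true]
    exact ⟨e.symm (i + 1), (hadj _ _).2 (by revert i; decide)⟩
  have hc : ∀ i : Fin 6, (SimpleGraph.cycleGraph 6).Adj (i + 1) (i + 2) ∧
      (SimpleGraph.cycleGraph 6).Adj (i + 2) (i + 3) ∧
      (SimpleGraph.cycleGraph 6).Adj (i + 3) (i + 4) ∧
      i + 2 ≠ i ∧ i + 3 ≠ i ∧ i + 4 ≠ i ∧ i + 3 ≠ i + 1 ∧ i + 4 ≠ i + 1 ∧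
      ¬ (SimpleGraph.cycleGraph 6).Adj i (i + 2) ∧ ¬ (SimpleGraph.cycleGraph 6).Adj i (i + 3) ∧
      ¬ (SimpleGraph.cycleGraph 6).Adj i (i + 4) ∧
      ¬ (SimpleGraph.cycleGraph 6).Adj (i + 1) (i + 3) ∧
      ¬ (SimpleGraph.cycleGraph 6).Adj (i + 1) (i + 4) := by decide
  refine le_movesLeft_dominator ⟨e.symm 0, playable_of_mem_active (hact _)⟩ fun v _ => ?_
  obtain ⟨i, rfl⟩ := e.symm.surjective v
  obtain ⟨h12, h23, h34, n20, n30, n40, n31, n41, a2, a3, a4, b3, b4⟩ := hc i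
  simp only [← hadj] at h12 h23 h34 a2 a3 a4 b3 b4
  rw [← hne] at n20 n30 n40 n31 n41
  have m2 : e.symm (i + 2) ∈ active G (insert (e.symm i) ∅) :=
    mem_active_insert.2 ⟨⟨hact _, n20, a2⟩, _, hact _, h23, n30, a3⟩
  have m3 : e.symm (i + 3) ∈ active G (insert (e.symm i) ∅) :=
    mem_active_insert.2 ⟨⟨hact _, n30, a3⟩, _, hact _, h23.symm, n20, a2⟩
  have m4 : e.symm (i + 4) ∈ active G (insert (e.symm i) ∅) :=
    mem_active_insert.2 ⟨⟨hact _, n40, a4⟩, _, hact _, h34.symm, n30, a3⟩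
  -- Staller's reply `i + 1` leaves the edge from `i + 3` to `i + 4`, which forces a third move.
  have m3' : e.symm (i + 3) ∈ active G (insert (e.symm (i + 1)) (insert (e.symm i) ∅)) :=
    mem_active_insert.2 ⟨⟨m3, n31, b3⟩, _, m4, h34, n41, b4⟩
  have := le_movesLeft_staller (playable_iff.2 ⟨_, m2, .inr h12⟩)
  have : 1 ≤ movesLeft G .dominator (insert (e.symm (i + 1)) (insert (e.symm i) ∅)) :=
    le_movesLeft_dominator ⟨_, playable_of_mem_active m3'⟩ fun _ _ => Nat.le_add_right _ _
  omega

theorem nonempty_iso_completeGraph_two (hG : G.Connected) (hn : Fintype.card V = 2) :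
    Nonempty (G ≃g SimpleGraph.completeGraph (Fin 2)) := by
  classical
  refine ⟨⟨Fintype.equivFinOfCardEq hn, @fun x y => ?_⟩⟩
  simp only [SimpleGraph.completeGraph, SimpleGraph.top_adj, ne_eq, EmbeddingLike.apply_eq_iff_eq]
  refine ⟨fun hxy => ?_, fun h => h.ne⟩
  have : Nontrivial V := ⟨x, y, hxy⟩
  obtain ⟨z, hz⟩ := hG.preconnected.exists_adj_of_nontrivial x
  have h := eq_univ_of_card {x, y} (by rw [card_pair hxy, hn])
  have hz' : z ∈ ({x, y} : Finset V) := h ▸ mem_univ z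
  rw [mem_insert, mem_singleton] at hz'
  rcases hz' with rfl | rfl
  exacts [absurd rfl hz.ne, hz]

theorem one_le_gameIsolationNumber [Nontrivial V] (hG : G.Connected) :
    1 ≤ gameIsolationNumber G := by
  obtain ⟨v⟩ := hG.nonempty
  exact le_movesLeft_dominator
    ⟨v, playable_of_mem_active (by simp [active_empty_of_connected hG])⟩
    fun _ _ => Nat.le_add_right _ _

theorem two_mul_gameIsolationNumber_le : 2 * gameIsolationNumber G ≤ Fintype.card V :=
  (two_mul_movesLeft_le ∅).1.trans (card_le_univ _)

theorem two_mul_gameIsolationNumber_eq_iff (hG : G.Connected) :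
    2 * gameIsolationNumber G = Fintype.card V ↔
      Nonempty (G ≃g SimpleGraph.completeGraph (Fin 2)) ∨
        Nonempty (G ≃g SimpleGraph.cycleGraph 6) := by
  have hle := two_mul_gameIsolationNumber_le (G := G)
  constructor
  · intro h
    have := hG.nonempty
    have := Fintype.card_pos (α := V)
    by_cases h4 : 4 ≤ Fintype.card V
    · exact .inr (nonempty_iso_cycleGraph_six_of_card_le hG (h ▸ even_two_mul _) h4 h.ge)
    -- The order is even, positive and below 4, hence 2.
    · exact .inl (nonempty_iso_completeGraph_two hG (by omega))
  · rintro (h | h)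
    · obtain ⟨e⟩ := h
      have hn : Fintype.card V = 2 := by simpa using Fintype.card_congr e.toEquiv
      have : Nontrivial V := Fintype.one_lt_card_iff_nontrivial.1 (by omega)
      have := one_le_gameIsolationNumber hG
      omega
    · obtain ⟨e⟩ := h
      have hn : Fintype.card V = 6 := by simpa using Fintype.card_congr e.toEquiv
      have := three_le_gameIsolationNumber e
      omega

end IsolationGame

theorem theorem3p1 {V : Type*} [Fintype V] (G : SimpleGraph V) (hG : G.Connected) :
    (IsolationGame.gameIsolationNumber G : ℝ) ≤ (Fintype.card V : ℝ) / 2 ∧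
      ((IsolationGame.gameIsolationNumber G : ℝ) = (Fintype.card V : ℝ) / 2 ↔
        Nonempty (G ≃g SimpleGraph.completeGraph (Fin 2)) ∨
          Nonempty (G ≃g SimpleGraph.cycleGraph 6)) := by
  rw [le_div_iff₀ two_pos, eq_div_iff two_ne_zero,
    ← IsolationGame.two_mul_gameIsolationNumber_eq_iff hG, mul_comm]
  refine ⟨?_, ?_⟩
  · exact_mod_cast IsolationGame.two_mul_gameIsolationNumber_le
  · exact_mod_cast Iff.rfl
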